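/- A convex body is a compact convex subset of $\mathbb{R}^n$ with non-empty interior; a set $A\subset\mathbb{R}^n$ is strictly convex if for any two distinct points $x,y\in A$ and every $t\in(0,1)$ the point $(1-t)x+ty$ lies in the interior of $A$. Let $n>1$, let $K,L\subset\mathbb{R}^n$ be strictly convex convex bodies, and let $$g_{K,L}(x)=|K\cap(L+x)|,\qquad x\in\mathbb{R}^n,$$ be their cross covariogram, where $|\cdot|$ denotes volume (Lebesgue measure). Suppose that $\max_{x\in\mathbb{R}^n} g_{K,L}(x)<\min\{|K|,|L|\}$. Then $g_{K,L}^{1/n}$ is strictly concave on its (closed, convex) support, i.e. for any two distinct points $x,y$ of the support and every $t\in(0,1)$, $$g_{K,L}^{1/n}\big((1-t)x+ty\big)>(1-t)\,g_{K,L}^{1/n}(x)+t\,g_{K,L}^{1/n}(y).$$ In particular, $g_{K,L}$ attains its maximum at exactly one point, and for every $t>0$ the level set $\{x\in\mathbb{R}^n : g_{K,L}(x)\ge t\}$ is strictly convex. -/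

import Mathlib

open MeasureTheory

/-- The cross covariogram `g_{K,L}(x) = |K ∩ (L + x)|` of two convex bodies in `ℝⁿ`, where `|·|` is
Lebesgue measure. As `K` is compact, the volume is finite, so it is taken as a real number. -/
noncomputable def crossCovariogram {n : ℕ} (K L : ConvexBody (EuclideanSpace ℝ (Fin n)))
    (x : EuclideanSpace ℝ (Fin n)) : ℝ :=
  volume.real ((K : Set (EuclideanSpace ℝ (Fin n))) ∩
    (fun y => y + x) '' (L : Set (EuclideanSpace ℝ (Fin n))))

/-! Put z = ax + by with a, b > 0, a + b = 1 and x ≠ y in the support. Both K ∩ (L + x) and K ∩ (L +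
y) are non-empty, and by convexity a(K ∩ (L + x)) + b(K ∩ (L + y)) ⊆ K ∩ (L + z). Brunn-Minkowski,
proved here via Prékopa-Leindler, then gives concavity of the n-th root.

Strictness needs no equality case of Brunn-Minkowski: the inclusion is proper
(`combo_translateInter_ssubset`), and a proper compact subset of a convex body has smaller volume.
Were it an equality, every frontier point of K ∩ (L + z) would be ap + bq with p, q in the two
intersections. Since x ≠ y, either p ≠ q or p - x ≠ q - y, so strict convexity puts the point in the
interior of K or of L + z. The frontier, connected because n > 1, would thus split into two disjoint
closed parts, so it would avoid the interior of one body entirely. That body would then lie in K ∩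
(L + z), against the bound on the maximum. -/

/-! ### One-dimensional Brunn-Minkowski. -/

open Set in
theorem Real.volume_add_volume_le_of_isCompact {S T U : Set ℝ} (hS : IsCompact S) (hT : IsCompact T)
    (hS₀ : S.Nonempty) (hT₀ : T.Nonempty) (h : ∀ s ∈ S, ∀ t ∈ T, s + t ∈ U) :
    volume S + volume T ≤ volume U := by
  obtain ⟨M, hM, hMS⟩ := hS.exists_isGreatest hS₀
  obtain ⟨m, hm, hmT⟩ := hT.exists_isLeast hT₀
  have hmeasS : MeasurableSet ((fun s => s + m) '' S) :=
    (hS.image (by fun_prop)).measurableSet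
  have hmeasT : MeasurableSet ((fun t => M + t) '' T) :=
    (hT.image (by fun_prop)).measurableSet
  -- Since s + m ≤ M + m ≤ M + t, the two translates meet at most at M + m.
  have hdisj : AEDisjoint volume ((fun s => s + m) '' S) ((fun t => M + t) '' T) := by
    refine measure_mono_null (t := {M + m}) ?_ (by simp)
    rintro _ ⟨⟨s, hs, rfl⟩, ⟨t, ht, hst⟩⟩
    have h1 := hMS hs
    have h2 := hmT ht
    simp only at hst
    simp only [mem_singleton_iff]
    linarith
  calc volume S + volume T
      = volume ((fun s => s + m) '' S) + volume ((fun t => M + t) '' T) := by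
        simp only [image_add_right, image_add_left, measure_preimage_add_right, measure_preimage_add]
    _ = volume ((fun s => s + m) '' S ∪ (fun t => M + t) '' T) :=
        (measure_union₀ hmeasT.nullMeasurableSet hdisj).symm
    _ ≤ volume U := by
        refine measure_mono (union_subset ?_ ?_)
        · rintro _ ⟨s, hs, rfl⟩
          exact h s hs m hm
        · rintro _ ⟨t, ht, rfl⟩
          exact h M hM t ht

/-- The one-dimensional Brunn-Minkowski inequality. -/
theorem Real.volume_add_volume_le {S T U : Set ℝ} (hS : MeasurableSet S) (hT : MeasurableSet T)
    (hS₀ : S.Nonempty) (hT₀ : T.Nonempty) (h : ∀ s ∈ S, ∀ t ∈ T, s + t ∈ U) :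
    volume S + volume T ≤ volume U := by
  obtain ⟨s₀, hs₀⟩ := hS₀
  obtain ⟨t₀, ht₀⟩ := hT₀
  rw [hS.measure_eq_iSup_isCompact, hT.measure_eq_iSup_isCompact]
  simp_rw [iSup_and']
  refine ENNReal.biSup_add_biSup_le' (p := fun K => K ⊆ S ∧ IsCompact K)
    (q := fun K => K ⊆ T ∧ IsCompact K) ⟨∅, by simp, isCompact_empty⟩
    ⟨∅, by simp, isCompact_empty⟩ ?_
  rintro A ⟨hAS, hA⟩ B ⟨hBT, hB⟩
  -- The approximating compact sets may be empty; adjoining a point keeps them compact and makes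
  -- them non-empty.
  refine (add_le_add (measure_mono (Set.subset_insert s₀ A))
    (measure_mono (Set.subset_insert t₀ B))).trans
    (volume_add_volume_le_of_isCompact (hA.insert s₀) (hB.insert t₀)
      (Set.insert_nonempty _ _) (Set.insert_nonempty _ _) ?_)
  intro s hs t ht
  exact h s (Set.insert_subset hs₀ hAS hs) t (Set.insert_subset ht₀ hBT ht)

open scoped Pointwise in
theorem Real.ofReal_mul_volume_add_le {S T U : Set ℝ} {a b : ℝ} (ha : 0 < a) (hb : 0 < b)
    (hS : MeasurableSet S) (hT : MeasurableSet T)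
    (hS₀ : S.Nonempty) (hT₀ : T.Nonempty) (h : ∀ s ∈ S, ∀ t ∈ T, a * s + b * t ∈ U) :
    ENNReal.ofReal a * volume S + ENNReal.ofReal b * volume T ≤ volume U := by
  have := Real.volume_add_volume_le (U := U) (hS.const_smul₀ a) (hT.const_smul₀ b)
    (hS₀.smul_set) (hT₀.smul_set) (by
      rintro _ ⟨s, hs, rfl⟩ _ ⟨t, ht, rfl⟩
      exact h s hs t ht)
  simpa [Measure.addHaar_smul, abs_of_pos ha, abs_of_pos hb] using this

/-! ### One-dimensional Prékopa-Leindler. -/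

theorem ENNReal.geom_mean_le_arith_mean2 {a b : ℝ} (ha : 0 < a) (hb : 0 < b) (hab : a + b = 1)
    (p q : ENNReal) : p ^ a * q ^ b ≤ ENNReal.ofReal a * p + ENNReal.ofReal b * q := by
  by_cases hp : p = ⊤
  · simp [hp, ENNReal.mul_top, ha]
  by_cases hq : q = ⊤
  · simp [hq, ENNReal.mul_top, hb]
  lift p to NNReal using hp
  lift q to NNReal using hq
  rw [← ENNReal.coe_rpow_of_nonneg _ ha.le, ← ENNReal.coe_rpow_of_nonneg _ hb.le, ENNReal.ofReal,
    ENNReal.ofReal]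
  norm_cast
  have := NNReal.geom_mean_le_arith_mean2_weighted a.toNNReal b.toNNReal p q
    (by rw [← Real.toNNReal_add ha.le hb.le, hab, Real.toNNReal_one])
  simpa [ha.le, hb.le] using this

-- Layer-cake: for 0 < r < 1 the superlevel sets satisfy a{f > r} + b{g > r} ⊆ {h > r}. Normalizing
-- both suprema to 1 makes the two sets on the left non-empty for exactly the same levels, as
-- one-dimensional Brunn-Minkowski requires.
open Set in
theorem ofReal_mul_lintegral_add_le {f g h : ℝ → ℝ} {a b : ℝ} (ha : 0 < a) (hb : 0 < b)
    (hab : a + b = 1)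
    (hf : Measurable f) (hg : Measurable g) (hh : Measurable h)
    (hf₀ : ∀ x, 0 ≤ f x) (hg₀ : ∀ x, 0 ≤ g x) (hh₀ : ∀ x, 0 ≤ h x)
    (hf₁ : ∀ x, f x ≤ 1) (hg₁ : ∀ x, g x ≤ 1)
    (hfs : ∀ r < 1, ∃ x, r < f x) (hgs : ∀ r < 1, ∃ x, r < g x)
    (H : ∀ x y, f x ^ a * g y ^ b ≤ h (a * x + b * y)) :
    ENNReal.ofReal a * (∫⁻ x, ENNReal.ofReal (f x)) +
      ENNReal.ofReal b * (∫⁻ x, ENNReal.ofReal (g x)) ≤ ∫⁻ x, ENNReal.ofReal (h x) := by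
  rw [lintegral_eq_lintegral_meas_lt _ (.of_forall hf₀) hf.aemeasurable,
    lintegral_eq_lintegral_meas_lt _ (.of_forall hg₀) hg.aemeasurable,
    lintegral_eq_lintegral_meas_lt _ (.of_forall hh₀) hh.aemeasurable,
    ← lintegral_const_mul' _ _ ENNReal.ofReal_ne_top,
    ← lintegral_const_mul' _ _ ENNReal.ofReal_ne_top]
  refine (le_lintegral_add _ _).trans (setLIntegral_mono' measurableSet_Ioi fun r hr => ?_)
  have hr : 0 < r := hr
  rcases lt_or_ge r 1 with hr1 | hr1
  · refine Real.ofReal_mul_volume_add_le ha hb (measurableSet_lt measurable_const hf)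
      (measurableSet_lt measurable_const hg) (hfs r hr1) (hgs r hr1) ?_
    intro x hx y hy
    have hx : r < f x := hx
    have hy : r < g y := hy
    calc r = r ^ a * r ^ b := by rw [← Real.rpow_add hr, hab, Real.rpow_one]
      _ < f x ^ a * g y ^ b := by gcongr
      _ ≤ _ := H x y
  · have h1 : {x | r < f x} = ∅ := by
      ext x; simpa using (hf₁ x).trans hr1
    have h2 : {x | r < g x} = ∅ := by
      ext x; simpa using (hg₁ x).trans hr1
    simp [h1, h2]

/-- The one-dimensional Prékopa-Leindler inequality for bounded functions. -/
theorem lintegral_rpow_mul_lintegral_rpow_le {f g h : ℝ → ℝ} {a b : ℝ} (ha : 0 < a) (hb : 0 < b)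
    (hab : a + b = 1)
    (hf : Measurable f) (hg : Measurable g) (hh : Measurable h)
    (hf₀ : ∀ x, 0 ≤ f x) (hg₀ : ∀ x, 0 ≤ g x) (hh₀ : ∀ x, 0 ≤ h x)
    (hfb : BddAbove (Set.range f)) (hgb : BddAbove (Set.range g))
    (H : ∀ x y, f x ^ a * g y ^ b ≤ h (a * x + b * y)) :
    (∫⁻ x, ENNReal.ofReal (f x)) ^ a * (∫⁻ x, ENNReal.ofReal (g x)) ^ b ≤
      ∫⁻ x, ENNReal.ofReal (h x) := by
  have hfF : ∀ x, f x ≤ ⨆ y, f y := le_ciSup hfb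
  have hgG : ∀ x, g x ≤ ⨆ y, g y := le_ciSup hgb
  rcases (le_ciSup_of_le hfb 0 (hf₀ 0)).eq_or_lt with hF | hF
  · have : ∀ x, f x = 0 := fun x => le_antisymm ((hfF x).trans hF.symm.le) (hf₀ x)
    simp [this, ENNReal.zero_rpow_of_pos ha]
  rcases (le_ciSup_of_le hgb 0 (hg₀ 0)).eq_or_lt with hG | hG
  · have : ∀ x, g x = 0 := fun x => le_antisymm ((hgG x).trans hG.symm.le) (hg₀ x)
    simp [this, ENNReal.zero_rpow_of_pos hb]
  have hFs : ∀ r < 1, ∃ x, r < f x / ⨆ y, f y := fun r hr => by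
    obtain ⟨x, hx⟩ := exists_lt_of_lt_ciSup (f := f) (b := r * ⨆ y, f y) (by nlinarith)
    exact ⟨x, by rwa [lt_div_iff₀ hF]⟩
  have hGs : ∀ r < 1, ∃ x, r < g x / ⨆ y, g y := fun r hr => by
    obtain ⟨x, hx⟩ := exists_lt_of_lt_ciSup (f := g) (b := r * ⨆ y, g y) (by nlinarith)
    exact ⟨x, by rwa [lt_div_iff₀ hG]⟩
  set F := ⨆ y, f y
  set G := ⨆ y, g y
  have hN : 0 < F ^ a * G ^ b := by positivity
  -- The inequality is homogeneous, so dividing by the suprema F, G and by F ^ a * G ^ b loses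
  -- nothing; AM-GM then yields the product form.
  have key := ofReal_mul_lintegral_add_le (f := fun x => f x / F) (g := fun x => g x / G)
    (h := fun x => h x / (F ^ a * G ^ b)) ha hb hab (hf.div_const _) (hg.div_const _)
    (hh.div_const _) (fun x => div_nonneg (hf₀ x) hF.le) (fun x => div_nonneg (hg₀ x) hG.le)
    (fun x => div_nonneg (hh₀ x) hN.le) (fun x => (div_le_one hF).2 (hfF x))
    (fun x => (div_le_one hG).2 (hgG x)) hFs hGs (by
      intro x y
      rw [Real.div_rpow (hf₀ x) hF.le, Real.div_rpow (hg₀ y) hG.le, div_mul_div_comm]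
      gcongr
      exact H x y)
  have key := (ENNReal.geom_mean_le_arith_mean2 ha hb hab _ _).trans key
  have hscale : ∀ (u : ℝ → ℝ) (c : ℝ), 0 < c → ∫⁻ x, ENNReal.ofReal (u x / c) =
      (∫⁻ x, ENNReal.ofReal (u x)) * (ENNReal.ofReal c)⁻¹ := by
    intro u c hc
    rw [← lintegral_mul_const' _ _ (by simpa using hc)]
    simp_rw [ENNReal.ofReal_div_of_pos hc, div_eq_mul_inv]
  rw [hscale f F hF, hscale g G hG, hscale h _ hN, ENNReal.mul_rpow_of_nonneg _ _ ha.le,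
    ENNReal.mul_rpow_of_nonneg _ _ hb.le, mul_mul_mul_comm, ENNReal.inv_rpow, ENNReal.inv_rpow,
    ENNReal.ofReal_rpow_of_pos hF, ENNReal.ofReal_rpow_of_pos hG, ENNReal.ofReal_mul (by positivity),
    ENNReal.mul_inv (by simp) (by simp)] at key
  refine (ENNReal.mul_le_mul_iff_left ?_ ?_).1 key
  · simp
  · refine ENNReal.mul_ne_top ?_ ?_ <;> simp <;> positivity

/-! ### Brunn-Minkowski in dimension n. -/

/-- The multiplicative form of the Brunn-Minkowski inequality in `Fin n → ℝ`. -/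
theorem volume_pi_rpow_mul_volume_rpow_le {a b : ℝ} (ha : 0 < a) (hb : 0 < b) (hab : a + b = 1)
    (n : ℕ) {A B C : Set (Fin n → ℝ)} (hA : MeasurableSet A) (hB : MeasurableSet B)
    (hC : MeasurableSet C) (hAb : Bornology.IsBounded A) (hBb : Bornology.IsBounded B)
    (hCb : Bornology.IsBounded C) (H : ∀ x ∈ A, ∀ y ∈ B, a • x + b • y ∈ C) :
    volume A ^ a * volume B ^ b ≤ volume C := by
  induction n with
  | zero =>
    rcases A.eq_empty_or_nonempty with rfl | ⟨x, hx⟩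
    · simp [ENNReal.zero_rpow_of_pos ha]
    rcases B.eq_empty_or_nonempty with rfl | ⟨y, hy⟩
    · simp [ENNReal.zero_rpow_of_pos hb]
    have hu : ∀ (S : Set (Fin 0 → ℝ)) (x), x ∈ S → S = Set.univ := fun S x hx => by
      ext z; simpa [Subsingleton.elim z x] using hx
    rw [hu A x hx, hu B y hy, hu C _ (H x hx y hy), ← ENNReal.rpow_add_of_nonneg _ _ ha.le hb.le,
      hab, ENNReal.rpow_one]
  | succ n ih =>
    -- Slices at a fixed first coordinate. By induction their volumes satisfy the Prékopa-Leindler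
    -- hypothesis, and by Fubini they integrate to the full volume.
    let σ : Set (Fin (n + 1) → ℝ) → ℝ → Set (Fin n → ℝ) := fun S s => {v | Fin.cons s v ∈ S}
    have hcons : Measurable fun p : ℝ × (Fin n → ℝ) => (Fin.cons p.1 p.2 : Fin (n + 1) → ℝ) := by
      refine measurable_pi_lambda _ fun i => ?_
      refine Fin.cases ?_ (fun j => ?_) i
      · simpa using measurable_fst
      · simpa using! (measurable_pi_apply j).comp measurable_snd
    have hσm : ∀ S, MeasurableSet S → ∀ s, MeasurableSet (σ S s) := fun S hS s =>
      (hcons.comp measurable_prodMk_left) hS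
    have hσb : ∀ S, Bornology.IsBounded S → ∃ R : Set (Fin n → ℝ), Bornology.IsBounded R ∧
        ∀ s, σ S s ⊆ R := by
      intro S hS
      obtain ⟨r, hr⟩ := hS.subset_closedBall 0
      refine ⟨Metric.closedBall 0 r, Metric.isBounded_closedBall, fun s v hv => ?_⟩
      have h1 := hr hv
      rw [mem_closedBall_zero_iff] at h1 ⊢
      have hr0 : 0 ≤ r := (norm_nonneg _).trans h1
      rw [pi_norm_le_iff_of_nonneg hr0] at h1 ⊢
      exact fun i => by simpa using h1 i.succ
    have hfin : ∀ S, Bornology.IsBounded S → ∀ s, volume (σ S s) ≠ ⊤ := fun S hS s => by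
      obtain ⟨R, hR, hs⟩ := hσb S hS
      exact (hR.subset (hs s)).measure_lt_top.ne
    have hbdd : ∀ S, Bornology.IsBounded S →
        BddAbove (Set.range fun s => volume.real (σ S s)) := by
      intro S hS
      obtain ⟨R, hR, hs⟩ := hσb S hS
      refine ⟨volume.real R, ?_⟩
      rintro _ ⟨s, rfl⟩
      exact measureReal_mono (hs s) hR.measure_lt_top.ne
    have hmeas : ∀ S, MeasurableSet S → Measurable fun s => volume.real (σ S s) := fun S hS =>
      (measurable_measure_prodMk_left (hcons hS)).ennreal_toReal
    have hvol : ∀ S, MeasurableSet S → Bornology.IsBounded S →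
        volume S = ∫⁻ s, ENNReal.ofReal (volume.real (σ S s)) := by
      intro S hS hSb
      have hp := (volume_preserving_piFinSuccAbove (fun _ : Fin (n + 1) => ℝ) 0).symm
      rw [← hp.measure_preimage hS.nullMeasurableSet, Measure.volume_eq_prod,
        Measure.prod_apply (hp.measurable hS)]
      refine lintegral_congr fun s => ?_
      rw [measureReal_def, ENNReal.ofReal_toReal (hfin S hSb s)]
      congr 1
      ext v
      simp [σ, MeasurableEquiv.piFinSuccAbove_symm_apply, Fin.insertNthEquiv]
    rw [hvol A hA hAb, hvol B hB hBb, hvol C hC hCb]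
    refine lintegral_rpow_mul_lintegral_rpow_le ha hb hab (hmeas A hA) (hmeas B hB) (hmeas C hC)
      (fun _ => measureReal_nonneg) (fun _ => measureReal_nonneg) (fun _ => measureReal_nonneg)
      (hbdd A hAb) (hbdd B hBb) fun s t => ?_
    have hbs : ∀ S, Bornology.IsBounded S → ∀ s, Bornology.IsBounded (σ S s) := fun S hS s => by
      obtain ⟨R, hR, hs⟩ := hσb S hS
      exact hR.subset (hs s)
    have := ih (hσm A hA s) (hσm B hB t) (hσm C hC (a * s + b * t)) (hbs A hAb s) (hbs B hBb t)
      (hbs C hCb _) (by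
        intro x hx y hy
        have := H _ hx _ hy
        change Fin.cons _ _ ∈ C
        convert this using 1
        ext i
        refine Fin.cases ?_ (fun j => ?_) i <;> simp)
    simp only [measureReal_def]
    rw [ENNReal.toReal_rpow, ENNReal.toReal_rpow, ← ENNReal.toReal_mul]
    exact ENNReal.toReal_mono (hfin C hCb _) this

theorem EuclideanSpace.volume_rpow_mul_volume_rpow_le {n : ℕ} {a b : ℝ} (ha : 0 < a) (hb : 0 < b)
    (hab : a + b = 1) {A B C : Set (EuclideanSpace ℝ (Fin n))} (hA : IsCompact A)
    (hB : IsCompact B) (hC : IsCompact C) (H : ∀ x ∈ A, ∀ y ∈ B, a • x + b • y ∈ C) :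
    volume A ^ a * volume B ^ b ≤ volume C := by
  have hp := PiLp.volume_preserving_toLp (Fin n)
  have hc : ∀ S : Set (EuclideanSpace ℝ (Fin n)), IsCompact S →
      IsCompact (WithLp.toLp 2 ⁻¹' S : Set (Fin n → ℝ)) := fun S hS =>
    (PiLp.homeomorph 2 (fun _ : Fin n => ℝ)).symm.isCompact_preimage.2 hS
  rw [← hp.measure_preimage hA.measurableSet.nullMeasurableSet,
    ← hp.measure_preimage hB.measurableSet.nullMeasurableSet,
    ← hp.measure_preimage hC.measurableSet.nullMeasurableSet]
  exact volume_pi_rpow_mul_volume_rpow_le ha hb hab n (hc A hA).measurableSet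
    (hc B hB).measurableSet (hc C hC).measurableSet (hc A hA).isBounded (hc B hB).isBounded
    (hc C hC).isBounded fun x hx y hy => H _ hx _ hy

open scoped Pointwise in
theorem EuclideanSpace.volume_real_smul {n : ℕ} {a : ℝ} (ha : 0 ≤ a)
    (S : Set (EuclideanSpace ℝ (Fin n))) : volume.real (a • S) = a ^ n * volume.real S := by
  rw [measureReal_def, Measure.addHaar_smul_of_nonneg _ ha, finrank_euclideanSpace_fin,
    ENNReal.toReal_mul, ENNReal.toReal_ofReal (by positivity), measureReal_def]

open scoped Pointwise in
/-- The Brunn-Minkowski inequality for compact sets. -/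
theorem EuclideanSpace.brunn_minkowski {n : ℕ} (hn : n ≠ 0)
    {A B : Set (EuclideanSpace ℝ (Fin n))} (hA : IsCompact A) (hB : IsCompact B)
    (hA₀ : A.Nonempty) (hB₀ : B.Nonempty) :
    volume.real A ^ (1 / n : ℝ) + volume.real B ^ (1 / n : ℝ) ≤
      volume.real (A + B) ^ (1 / n : ℝ) := by
  have hn' : (0 : ℝ) < 1 / n := by positivity
  have hAB := hA.add hB
  rcases (measureReal_nonneg (μ := volume) (s := A)).eq_or_lt with hA1 | hA1
  · obtain ⟨x, hx⟩ := hA₀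
    rw [← hA1, Real.zero_rpow hn'.ne', zero_add]
    refine Real.rpow_le_rpow measureReal_nonneg ?_ hn'.le
    calc volume.real B = volume.real ({x} + B) := by
          simp [measureReal_def, Set.singleton_add, Set.image_add_left, measure_preimage_add]
      _ ≤ _ := measureReal_mono (Set.add_subset_add_right (by simpa using hx))
          hAB.measure_lt_top.ne
  rcases (measureReal_nonneg (μ := volume) (s := B)).eq_or_lt with hB1 | hB1
  · obtain ⟨x, hx⟩ := hB₀
    rw [← hB1, Real.zero_rpow hn'.ne', add_zero]
    refine Real.rpow_le_rpow measureReal_nonneg ?_ hn'.le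
    calc volume.real A = volume.real (A + {x}) := by
          simp [measureReal_def, Set.add_singleton, Set.image_add_right,
            measure_preimage_add_right]
      _ ≤ _ := measureReal_mono (Set.add_subset_add_left (by simpa using hx))
          hAB.measure_lt_top.ne
  set p := volume.real A ^ (1 / n : ℝ) with hp
  set q := volume.real B ^ (1 / n : ℝ) with hq
  have hp0 : 0 < p := Real.rpow_pos_of_pos hA1 _
  have hq0 : 0 < q := Real.rpow_pos_of_pos hB1 _
  have hpn : p ^ n = volume.real A := by
    rw [hp, one_div, Real.rpow_inv_natCast_pow hA1.le hn]
  have hqn : q ^ n = volume.real B := by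
    rw [hq, one_div, Real.rpow_inv_natCast_pow hB1.le hn]
  have hpA : volume.real (p⁻¹ • A) = 1 := by
    rw [volume_real_smul (by positivity), inv_pow, hpn, inv_mul_cancel₀ hA1.ne']
  have hqB : volume.real (q⁻¹ • B) = 1 := by
    rw [volume_real_smul (by positivity), inv_pow, hqn, inv_mul_cancel₀ hB1.ne']
  -- Rescaled to unit volume, A / p and B / q with weights p / (p + q) and q / (p + q) combine to (A
  -- + B) / (p + q), whose volume is therefore at least 1.
  have key := volume_rpow_mul_volume_rpow_le (a := p / (p + q)) (b := q / (p + q))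
    (A := p⁻¹ • A) (B := q⁻¹ • B) (C := (p + q)⁻¹ • (A + B)) (by positivity) (by positivity)
    (by field_simp) (hA.smul _) (hB.smul _) (hAB.smul _) (by
      rintro _ ⟨x, hx, rfl⟩ _ ⟨y, hy, rfl⟩
      refine ⟨x + y, Set.add_mem_add hx hy, ?_⟩
      simp only [smul_smul, smul_add]
      congr 2 <;> field_simp)
  rw [(ENNReal.toReal_eq_one_iff _).1 hpA, (ENNReal.toReal_eq_one_iff _).1 hqB, ENNReal.one_rpow,
    ENNReal.one_rpow, one_mul] at key
  have key := ENNReal.toReal_mono (hAB.smul _).measure_lt_top.ne key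
  rw [ENNReal.toReal_one, ← measureReal_def, volume_real_smul (by positivity), inv_pow,
    inv_mul_eq_div, one_le_div (by positivity)] at key
  calc p + q = ((p + q) ^ n) ^ (1 / n : ℝ) := by
        rw [one_div, Real.pow_rpow_inv_natCast (by positivity) hn]
    _ ≤ _ := by gcongr

open scoped Pointwise in
theorem EuclideanSpace.brunn_minkowski_smul {n : ℕ} (hn : n ≠ 0) {a b : ℝ} (ha : 0 ≤ a)
    (hb : 0 ≤ b) {A B : Set (EuclideanSpace ℝ (Fin n))} (hA : IsCompact A) (hB : IsCompact B)
    (hA₀ : A.Nonempty) (hB₀ : B.Nonempty) :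
    a * volume.real A ^ (1 / n : ℝ) + b * volume.real B ^ (1 / n : ℝ) ≤
      volume.real (a • A + b • B) ^ (1 / n : ℝ) := by
  have h := brunn_minkowski hn (hA.smul a) (hB.smul b) hA₀.smul_set hB₀.smul_set
  rwa [volume_real_smul ha, volume_real_smul hb, Real.mul_rpow (by positivity) measureReal_nonneg,
    Real.mul_rpow (by positivity) measureReal_nonneg, one_div, Real.pow_rpow_inv_natCast ha hn,
    Real.pow_rpow_inv_natCast hb hn, ← one_div] at h

/-! ### Convex sets and intersections with translates. -/

section

variable {E : Type*} [NormedAddCommGroup E]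

/-- The intersection `s ∩ (t + x)`. -/
def translateInter (s t : Set E) (x : E) : Set E := s ∩ (fun y => y - x) ⁻¹' t

theorem IsCompact.translateInter {s t : Set E} (hs : IsCompact s) (ht : IsClosed t) (x : E) :
    IsCompact (translateInter s t x) :=
  hs.inter_right (ht.preimage (by fun_prop))

theorem interior_preimage_sub_const (t : Set E) (x : E) :
    interior ((fun y => y - x) ⁻¹' t) = (fun y => y - x) ⁻¹' interior t :=
  ((Homeomorph.subRight x).preimage_interior t).symm

variable [NormedSpace ℝ E]

/-- The frontier of a bounded convex set with interior points is connected in dimension at least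
two. -/
theorem Convex.isPreconnected_frontier {s : Set E} (hE : 1 < Module.rank ℝ E) (hs : Convex ℝ s)
    (hne : (interior s).Nonempty) (hb : Bornology.IsBounded s) : IsPreconnected (frontier s) := by
  obtain ⟨e, -, -, he⟩ := exists_homeomorph_image_interior_closure_frontier_eq_unitBall hs hne hb
  have := isPreconnected_sphere hE (0 : E) 1
  rw [← he] at this
  simpa using this.image e.symm e.symm.continuous.continuousOn

/-- A segment from an interior point of `s` to a point of `t` outside `s` crosses the frontier of
`s` before its end, hence at an interior point of `t`. -/
theorem Convex.subset_of_frontier_subset_compl_interior {s t : Set E} (ht : Convex ℝ t)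
    (hs : IsClosed s) (hst : s ⊆ t) (hne : (interior s).Nonempty)
    (h : frontier s ⊆ (interior t)ᶜ) : t ⊆ s := by
  intro p hp
  by_contra hps
  obtain ⟨q, hq⟩ := hne
  have hqt : q ∈ interior t := interior_mono hst hq
  obtain ⟨c, hc, hcs⟩ : (segment ℝ q p ∩ frontier s).Nonempty := by
    by_contra hempty
    have hsub : segment ℝ q p ⊆ interior s ∪ sᶜ := by
      intro c hc
      by_contra hcs
      simp only [Set.mem_union, Set.mem_compl_iff, not_or, not_not] at hcs
      exact hempty ⟨c, hc, hs.frontier_eq ▸ ⟨hcs.2, hcs.1⟩⟩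
    have := (convex_segment q p).isPreconnected.subset_left_of_subset_union isOpen_interior
      hs.isOpen_compl (Set.disjoint_compl_right_iff_subset.2 interior_subset) hsub
      ⟨q, left_mem_segment ℝ q p, hq⟩
    exact hps (interior_subset (this (right_mem_segment ℝ q p)))
  rw [hs.frontier_eq] at hcs
  refine h (hs.frontier_eq ▸ hcs) ?_
  rw [← insert_endpoints_openSegment] at hc
  rcases hc with rfl | rfl | hc
  · exact hqt
  · exact absurd hcs.1 hps
  · exact ht.openSegment_interior_self_subset_interior hqt hp hc

theorem Convex.subset_closure_interior {s : Set E} (hs : Convex ℝ s) (hne : (interior s).Nonempty) :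
    s ⊆ closure (interior s) := by
  rw [hs.closure_interior_eq_closure_of_nonempty_interior hne]
  exact subset_closure

/-- A point of `t` off `s` is a limit of interior points of `t`, so `interior t` minus `s` is open
and non-empty, hence of positive measure. -/
theorem Convex.measureReal_lt_of_isClosed_of_ssubset [MeasurableSpace E] [BorelSpace E]
    {μ : Measure E} [μ.IsOpenPosMeasure] [IsFiniteMeasureOnCompacts μ] {s t : Set E}
    (ht : Convex ℝ t) (htc : IsCompact t) (hne : (interior t).Nonempty) (hs : IsClosed s)
    (hst : s ⊂ t) : μ.real s < μ.real t := by
  obtain ⟨hst, hts⟩ := hst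
  obtain ⟨p, hpt, hps⟩ := Set.not_subset.1 hts
  obtain ⟨q, hq⟩ := mem_closure_iff.1 (ht.subset_closure_interior hne hpt) sᶜ hs.isOpen_compl hps
  have hopen : IsOpen (sᶜ ∩ interior t) := hs.isOpen_compl.inter isOpen_interior
  have hpos : 0 < μ.real (sᶜ ∩ interior t) :=
    ENNReal.toReal_pos (hopen.measure_pos μ ⟨q, hq⟩).ne'
      (measure_ne_top_of_subset (Set.inter_subset_right.trans interior_subset) htc.measure_lt_top.ne)
  calc μ.real s < μ.real s + μ.real (sᶜ ∩ interior t) := by linarith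
    _ = μ.real (s ∪ (sᶜ ∩ interior t)) :=
      (measureReal_union (disjoint_compl_right.mono_right Set.inter_subset_left)
        hopen.measurableSet (measure_ne_top_of_subset hst htc.measure_lt_top.ne)
        (measure_ne_top_of_subset (Set.inter_subset_right.trans interior_subset) htc.measure_lt_top.ne)).symm
    _ ≤ μ.real t := measureReal_mono
      (Set.union_subset hst (Set.inter_subset_right.trans interior_subset)) htc.measure_lt_top.ne

variable {s t : Set E} {x y : E} {a b : ℝ}

theorem Convex.translateInter (hs : Convex ℝ s) (ht : Convex ℝ t) (x : E) :
    Convex ℝ (translateInter s t x) := by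
  refine hs.inter ?_
  simpa [sub_eq_add_neg] using ht.translate_preimage_left (-x)

theorem combo_sub_combo (a b : ℝ) (p q x y : E) :
    a • p + b • q - (a • x + b • y) = a • (p - x) + b • (q - y) := by
  module

open scoped Pointwise in
theorem combo_translateInter_subset (hs : Convex ℝ s) (ht : Convex ℝ t) (ha : 0 ≤ a) (hb : 0 ≤ b)
    (hab : a + b = 1) :
    a • translateInter s t x + b • translateInter s t y ⊆
      translateInter s t (a • x + b • y) := by
  rintro _ ⟨_, ⟨p, hp, rfl⟩, _, ⟨q, hq, rfl⟩, rfl⟩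
  refine ⟨hs hp.1 hq.1 ha hb hab, ?_⟩
  simp only [Set.mem_preimage, combo_sub_combo]
  exact ht hp.2 hq.2 ha hb hab

/-- For p, q in the two intersections, p ≠ q or p - x ≠ q - y. So ap + bq is interior to one of the
sets `s`, `t + (ax + by)` and in the closure of the interior of the other; the two interiors
therefore meet. -/
theorem interior_translateInter_nonempty (hs : StrictConvex ℝ s) (ht : StrictConvex ℝ t)
    (hsi : (interior s).Nonempty) (hti : (interior t).Nonempty)
    (hx : (translateInter s t x).Nonempty) (hy : (translateInter s t y).Nonempty) (hxy : x ≠ y)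
    (ha : 0 < a) (hb : 0 < b) (hab : a + b = 1) :
    (interior (translateInter s t (a • x + b • y))).Nonempty := by
  obtain ⟨p, hp⟩ := hx
  obtain ⟨q, hq⟩ := hy
  have hc : a • p + b • q ∈ s := hs.convex hp.1 hq.1 ha.le hb.le hab
  have hd : a • (p - x) + b • (q - y) ∈ t := ht.convex hp.2 hq.2 ha.le hb.le hab
  rw [translateInter, interior_inter, interior_preimage_sub_const]
  rw [← combo_sub_combo] at hd
  by_cases hpq : p = q
  · have hne : p - x ≠ q - y := by
      rintro h
      exact hxy (by simpa [hpq] using h)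
    have hd' := ht hp.2 hq.2 hne ha hb hab
    rw [← combo_sub_combo] at hd'
    obtain ⟨r, hr⟩ := mem_closure_iff.1 (hs.convex.subset_closure_interior hsi hc) _
      (isOpen_interior.preimage (continuous_id.sub continuous_const)) hd'
    exact ⟨r, hr.2, hr.1⟩
  · have hc' := hs hp.1 hq.1 hpq ha hb hab
    obtain ⟨r, hr⟩ := mem_closure_iff.1 (ht.convex.subset_closure_interior hti hd)
      ((fun r => r + (a • x + b • y)) ⁻¹' interior s)
      (isOpen_interior.preimage (continuous_id.add continuous_const)) (by simpa using hc')
    exact ⟨r + (a • x + b • y), hr.1, by simpa using hr.2⟩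

open scoped Pointwise in
theorem combo_translateInter_ssubset (hE : 1 < Module.rank ℝ E) (hs : StrictConvex ℝ s)
    (ht : StrictConvex ℝ t) (hsc : IsCompact s) (htc : IsCompact t)
    (hsi : (interior s).Nonempty) (hti : (interior t).Nonempty)
    (hx : (translateInter s t x).Nonempty) (hy : (translateInter s t y).Nonempty) (hxy : x ≠ y)
    (ha : 0 < a) (hb : 0 < b) (hab : a + b = 1)
    (hs' : ¬ s ⊆ translateInter s t (a • x + b • y))
    (ht' : ¬ (fun r => r - (a • x + b • y)) ⁻¹' t ⊆ translateInter s t (a • x + b • y)) :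
    a • translateInter s t x + b • translateInter s t y ⊂
      translateInter s t (a • x + b • y) := by
  refine (combo_translateInter_subset hs.convex ht.convex ha.le hb.le hab).ssubset_of_ne ?_
  intro heq
  have hi := interior_translateInter_nonempty hs ht hsi hti hx hy hxy ha hb hab
  have hcomp := hsc.translateInter htc.isClosed (a • x + b • y)
  have hconv := hs.convex.translateInter ht.convex (a • x + b • y)
  have hpre := hconv.isPreconnected_frontier hE hi hcomp.isBounded
  set z := a • x + b • y with hz
  have hFs : IsClosed (interior s)ᶜ := isOpen_interior.isClosed_compl
  have hFt : IsClosed (interior ((fun r => r - z) ⁻¹' t))ᶜ := isOpen_interior.isClosed_compl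
  have hcover : frontier (translateInter s t z) ⊆
      (interior s)ᶜ ∪ (interior ((fun r => r - z) ⁻¹' t))ᶜ := by
    rw [← Set.compl_inter, ← interior_inter]
    exact fun c hc => hc.2
  -- A point in both closed sets would force p = q and p - x = q - y, hence x = y.
  have hdisj : frontier (translateInter s t z) ∩
      ((interior s)ᶜ ∩ (interior ((fun r => r - z) ⁻¹' t))ᶜ) = ∅ := by
    rw [Set.eq_empty_iff_forall_notMem]
    rintro c ⟨hc, hcs, hct⟩
    have hc' := hcomp.isClosed.frontier_subset hc
    rw [← heq] at hc'
    obtain ⟨_, ⟨p, hp, rfl⟩, _, ⟨q, hq, rfl⟩, rfl⟩ := hc'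
    rw [interior_preimage_sub_const] at hct
    simp only [Set.mem_compl_iff, Set.mem_preimage, hz, combo_sub_combo] at hcs hct
    have h1 : p = q := by
      by_contra hne
      exact hcs (hs hp.1 hq.1 hne ha hb hab)
    have h2 : p - x = q - y := by
      by_contra hne
      exact hct (ht hp.2 hq.2 hne ha hb hab)
    exact hxy (by simpa [h1] using h2)
  rcases isPreconnected_iff_subset_of_disjoint_closed.1 hpre _ _ hFs hFt hcover hdisj with h | h
  · exact hs' (hs.convex.subset_of_frontier_subset_compl_interior hcomp.isClosed
      Set.inter_subset_left hi h)
  · refine ht' (Convex.subset_of_frontier_subset_compl_interior ?_ hcomp.isClosed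
      Set.inter_subset_right hi h)
    simpa [sub_eq_add_neg] using ht.convex.translate_preimage_left (-z)


/-- Dominated convergence: the indicator of `t` at y - x is continuous in x unless y - x is on the
frontier of `t`, which is null by convexity. -/
theorem continuous_measureReal_translateInter [MeasurableSpace E] [BorelSpace E]
    [FiniteDimensional ℝ E] (μ : Measure E) [μ.IsAddHaarMeasure] (hs : IsCompact s)
    (ht : Convex ℝ t) (htc : IsClosed t) :
    Continuous fun x => μ.real (translateInter s t x) := by
  have hform : ∀ x, μ.real (translateInter s t x) =
      ∫ y in s, t.indicator (fun _ => (1 : ℝ)) (y - x) ∂μ := by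
    intro x
    have hm : MeasurableSet ((fun y => y - x) ⁻¹' t) :=
      (htc.preimage (by fun_prop)).measurableSet
    have : (fun y => t.indicator (fun _ => (1 : ℝ)) (y - x)) =
        ((fun y => y - x) ⁻¹' t).indicator 1 := by
      ext y; simp [Set.indicator]; rfl
    rw [this, integral_indicator_one hm, measureReal_restrict_apply hm, translateInter,
      Set.inter_comm]
  simp_rw [hform]
  rw [continuous_iff_continuousAt]
  intro x
  have : IsFiniteMeasure (μ.restrict s) := ⟨by simpa using hs.measure_lt_top⟩
  refine continuousAt_of_dominated (bound := fun _ => 1) (.of_forall fun x => ?_)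
    (.of_forall fun x => .of_forall fun y => ?_) (integrable_const _) ?_
  · exact ((measurable_const.indicator htc.measurableSet).comp
      (measurable_id.sub_const x)).aestronglyMeasurable
  · exact (norm_indicator_le_norm_self _ _).trans (by simp)
  · have hnull : μ ((fun y => y - x) ⁻¹' frontier t) = 0 := by
      simp only [sub_eq_add_neg, measure_preimage_add_right, ht.addHaar_frontier μ]
    refine ae_restrict_of_ae ?_
    filter_upwards [measure_eq_zero_iff_ae_notMem.1 hnull] with y hy
    have h1 : ContinuousAt (t.indicator fun _ => (1 : ℝ)) (y - x) :=
      continuousOn_const.continuousAt_indicator hy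
    exact ContinuousAt.comp (f := fun x => y - x) h1 (by fun_prop)

end

/-! ### Strict inequality for volumes of intersections. -/

open scoped Pointwise in
theorem EuclideanSpace.combo_rpow_volume_translateInter_lt {n : ℕ} (hn : 1 < n)
    {s t : Set (EuclideanSpace ℝ (Fin n))} {x y : EuclideanSpace ℝ (Fin n)} {a b : ℝ}
    (hs : StrictConvex ℝ s) (ht : StrictConvex ℝ t) (hsc : IsCompact s) (htc : IsCompact t)
    (hsi : (interior s).Nonempty) (hti : (interior t).Nonempty)
    (hx : (translateInter s t x).Nonempty) (hy : (translateInter s t y).Nonempty) (hxy : x ≠ y)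
    (ha : 0 < a) (hb : 0 < b) (hab : a + b = 1)
    (hlt : volume.real (translateInter s t (a • x + b • y)) < min (volume.real s) (volume.real t)) :
    a * volume.real (translateInter s t x) ^ (1 / n : ℝ) +
        b * volume.real (translateInter s t y) ^ (1 / n : ℝ) <
      volume.real (translateInter s t (a • x + b • y)) ^ (1 / n : ℝ) := by
  have hfin := (hsc.translateInter htc.isClosed (a • x + b • y)).measure_lt_top (μ := volume)
  rw [lt_min_iff] at hlt
  -- If the intersection contained either whole set, its volume would reach the minimum in `hlt`.
  have hss := combo_translateInter_ssubset
    (Module.one_lt_rank_of_one_lt_finrank (by simpa using hn)) hs ht hsc htc hsi hti hx hy hxy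
    ha hb hab (fun h => hlt.1.not_ge (measureReal_mono h hfin.ne)) (fun h => by
      refine hlt.2.not_ge ?_
      refine le_of_eq_of_le ?_ (measureReal_mono h hfin.ne)
      simp only [measureReal_def, sub_eq_add_neg, measure_preimage_add_right])
  have hcx := hsc.translateInter htc.isClosed x
  have hcy := hsc.translateInter htc.isClosed y
  refine (brunn_minkowski_smul (by lia) ha.le hb.le hcx hcy hx hy).trans_lt
    (Real.rpow_lt_rpow measureReal_nonneg ?_ (by positivity))
  exact (hs.convex.translateInter ht.convex _).measureReal_lt_of_isClosed_of_ssubset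
    (hsc.translateInter htc.isClosed _)
    (interior_translateInter_nonempty hs ht hsi hti hx hy hxy ha hb hab)
    ((hcx.smul a).add (hcy.smul b)).isClosed hss

/-! ### The cross covariogram. -/

section

variable {n : ℕ} (K L : ConvexBody (EuclideanSpace ℝ (Fin n)))

theorem crossCovariogram_eq (x : EuclideanSpace ℝ (Fin n)) :
    crossCovariogram K L x = volume.real (translateInter (K : Set _) L x) := by
  simp [crossCovariogram, translateInter, Set.image_add_right, sub_eq_add_neg]

theorem crossCovariogram_nonneg (x : EuclideanSpace ℝ (Fin n)) : 0 ≤ crossCovariogram K L x :=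
  measureReal_nonneg

theorem crossCovariogram_le_iSup (x : EuclideanSpace ℝ (Fin n)) :
    crossCovariogram K L x ≤ ⨆ x, crossCovariogram K L x := by
  -- A real supremum is meaningful only for a bounded family; the volume of K is a bound.
  refine le_ciSup ⟨volume.real (K : Set (EuclideanSpace ℝ (Fin n))), ?_⟩ x
  rintro _ ⟨x, rfl⟩
  exact measureReal_mono Set.inter_subset_left K.isCompact.measure_lt_top.ne

theorem continuous_crossCovariogram : Continuous (crossCovariogram K L) := by
  rw [funext (crossCovariogram_eq K L)]
  exact continuous_measureReal_translateInter volume K.isCompact L.convex L.isClosed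

open scoped Pointwise in
theorem translateInter_nonempty_iff (x : EuclideanSpace ℝ (Fin n)) :
    (translateInter (K : Set (EuclideanSpace ℝ (Fin n))) L x).Nonempty ↔
      x ∈ (K : Set (EuclideanSpace ℝ (Fin n))) - L := by
  constructor
  · rintro ⟨p, hp, hpx⟩
    exact ⟨p, hp, p - x, hpx, by simp⟩
  · rintro ⟨p, hp, q, hq, rfl⟩
    exact ⟨p, hp, by simpa using hq⟩

open scoped Pointwise in
theorem isCompact_sub_convexBody : 
    IsCompact ((K : Set (EuclideanSpace ℝ (Fin n))) - (L : Set (EuclideanSpace ℝ (Fin n)))) := by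
  rw [sub_eq_add_neg]
  exact K.isCompact.add L.isCompact.neg

-- Ensures that the intersections are non-empty on all of the closed support, including points where
-- the covariogram vanishes.
open scoped Pointwise in
theorem tsupport_crossCovariogram_subset :
    tsupport (crossCovariogram K L) ⊆ (K : Set (EuclideanSpace ℝ (Fin n))) - L := by
  refine closure_minimal (fun x hx => ?_) (isCompact_sub_convexBody K L).isClosed
  rw [← translateInter_nonempty_iff]
  by_contra h
  rw [Set.not_nonempty_iff_eq_empty] at h
  exact hx (by simp [crossCovariogram_eq, h])

theorem hasCompactSupport_crossCovariogram : HasCompactSupport (crossCovariogram K L) :=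
  (isCompact_sub_convexBody K L).of_isClosed_subset (isClosed_tsupport _)
    (tsupport_crossCovariogram_subset K L)

variable {K L}

theorem crossCovariogram_pos_of_interior_nonempty {x : EuclideanSpace ℝ (Fin n)}
    (h : (interior (translateInter (K : Set (EuclideanSpace ℝ (Fin n))) L x)).Nonempty) :
    0 < crossCovariogram K L x := by
  rw [crossCovariogram_eq]
  exact ENNReal.toReal_pos (Measure.measure_pos_of_nonempty_interior _ h).ne'
    (K.isCompact.translateInter L.isClosed x).measure_lt_top.ne

theorem exists_crossCovariogram_pos
    (hK : (interior (K : Set (EuclideanSpace ℝ (Fin n)))).Nonempty)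
    (hL : (interior (L : Set (EuclideanSpace ℝ (Fin n)))).Nonempty) :
    ∃ x, 0 < crossCovariogram K L x := by
  obtain ⟨p, hp⟩ := hK
  obtain ⟨q, hq⟩ := hL
  refine ⟨p - q, crossCovariogram_pos_of_interior_nonempty ⟨p, ?_⟩⟩
  rw [translateInter, interior_inter, interior_preimage_sub_const]
  exact ⟨hp, by simpa using hq⟩

theorem convex_tsupport_crossCovariogram
    (hK : (interior (K : Set (EuclideanSpace ℝ (Fin n)))).Nonempty)
    (hL : (interior (L : Set (EuclideanSpace ℝ (Fin n)))).Nonempty)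
    (hKs : StrictConvex ℝ (K : Set (EuclideanSpace ℝ (Fin n))))
    (hLs : StrictConvex ℝ (L : Set (EuclideanSpace ℝ (Fin n)))) :
    Convex ℝ (tsupport (crossCovariogram K L)) := by
  refine Convex.closure (convex_iff_pairwise_pos.2 fun x hx y hy hxy a b ha hb hab => ?_)
  have hne : ∀ x ∈ Function.support (crossCovariogram K L),
      (translateInter (K : Set (EuclideanSpace ℝ (Fin n))) L x).Nonempty := fun x hx =>
    (translateInter_nonempty_iff K L x).2 (tsupport_crossCovariogram_subset K L
      (subset_tsupport _ hx))
  exact (crossCovariogram_pos_of_interior_nonempty (interior_translateInter_nonempty hKs hLs hK hL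
    (hne x hx) (hne y hy) hxy ha hb hab)).ne'

theorem strictConcaveOn_crossCovariogram_rpow (hn : 1 < n)
    (hK : (interior (K : Set (EuclideanSpace ℝ (Fin n)))).Nonempty)
    (hL : (interior (L : Set (EuclideanSpace ℝ (Fin n)))).Nonempty)
    (hKs : StrictConvex ℝ (K : Set (EuclideanSpace ℝ (Fin n))))
    (hLs : StrictConvex ℝ (L : Set (EuclideanSpace ℝ (Fin n))))
    (hmax : (⨆ x, crossCovariogram K L x) <
      min (volume.real (K : Set (EuclideanSpace ℝ (Fin n))))
        (volume.real (L : Set (EuclideanSpace ℝ (Fin n))))) :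
    StrictConcaveOn ℝ (tsupport (crossCovariogram K L))
      (fun x => crossCovariogram K L x ^ (1 / (n : ℝ))) := by
  refine ⟨convex_tsupport_crossCovariogram hK hL hKs hLs, ?_⟩
  intro x hx y hy hxy a b ha hb hab
  simp only [smul_eq_mul, crossCovariogram_eq]
  refine EuclideanSpace.combo_rpow_volume_translateInter_lt hn hKs hLs K.isCompact L.isCompact hK hL
    ((translateInter_nonempty_iff K L x).2 (tsupport_crossCovariogram_subset K L hx))
    ((translateInter_nonempty_iff K L y).2 (tsupport_crossCovariogram_subset K L hy))
    hxy ha hb hab ?_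
  rw [← crossCovariogram_eq]
  exact (crossCovariogram_le_iSup K L _).trans_lt hmax

end

theorem theorem1 (n : ℕ) (hn : 1 < n)
    (K L : ConvexBody (EuclideanSpace ℝ (Fin n)))
    (hK : (interior (K : Set (EuclideanSpace ℝ (Fin n)))).Nonempty)
    (hL : (interior (L : Set (EuclideanSpace ℝ (Fin n)))).Nonempty)
    (hKs : StrictConvex ℝ (K : Set (EuclideanSpace ℝ (Fin n))))
    (hLs : StrictConvex ℝ (L : Set (EuclideanSpace ℝ (Fin n))))
    (hmax : (⨆ x, crossCovariogram K L x) <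
      min (volume.real (K : Set (EuclideanSpace ℝ (Fin n))))
        (volume.real (L : Set (EuclideanSpace ℝ (Fin n))))) :
    StrictConcaveOn ℝ (tsupport (crossCovariogram K L))
        (fun x => crossCovariogram K L x ^ (1 / (n : ℝ))) ∧
      (∃! x, IsMaxOn (crossCovariogram K L) Set.univ x) ∧
      ∀ t : ℝ, 0 < t → StrictConvex ℝ {x | t ≤ crossCovariogram K L x} := by
  have hconc := strictConcaveOn_crossCovariogram_rpow hn hK hL hKs hLs hmax
  have hcont := continuous_crossCovariogram K L
  have hn' : (0 : ℝ) < 1 / n := by positivity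
  have hsupp : ∀ x, 0 < crossCovariogram K L x → x ∈ tsupport (crossCovariogram K L) :=
    fun x hx => subset_tsupport _ hx.ne'
  refine ⟨hconc, ?_, ?_⟩
  · obtain ⟨x₀, hx₀⟩ := hcont.exists_forall_ge_of_hasCompactSupport
      (hasCompactSupport_crossCovariogram K L)
    obtain ⟨p, hp⟩ := exists_crossCovariogram_pos hK hL
    -- The maximum is positive, so every maximizer lies in the support, where strict concavity
    -- allows only one.
    have hmaxpow : ∀ x, IsMaxOn (crossCovariogram K L) Set.univ x →
        x ∈ tsupport (crossCovariogram K L) ∧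
        IsMaxOn (fun x => crossCovariogram K L x ^ (1 / (n : ℝ)))
          (tsupport (crossCovariogram K L)) x := fun x hx =>
      ⟨hsupp x (hp.trans_le (hx (Set.mem_univ p))), fun y _ =>
        Real.rpow_le_rpow (crossCovariogram_nonneg K L y) (hx (Set.mem_univ y)) hn'.le⟩
    have hx₀' : IsMaxOn (crossCovariogram K L) Set.univ x₀ := fun y _ => hx₀ y
    exact ⟨x₀, hx₀', fun y hy => hconc.eq_of_isMaxOn (hmaxpow y hy).2 (hmaxpow x₀ hx₀').2
      (hmaxpow y hy).1 (hmaxpow x₀ hx₀').1⟩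
  · intro t ht x hx y hy hxy a b ha hb hab
    have hx : t ≤ crossCovariogram K L x := hx
    have hy : t ≤ crossCovariogram K L y := hy
    have h := hconc.2 (hsupp x (ht.trans_le hx)) (hsupp y (ht.trans_le hy)) hxy ha hb hab
    have hlt : t < crossCovariogram K L (a • x + b • y) := by
      refine (Real.rpow_lt_rpow_iff ht.le (crossCovariogram_nonneg K L _) hn').1
        (lt_of_le_of_lt ?_ h)
      calc t ^ (1 / n : ℝ) = a * t ^ (1 / n : ℝ) + b * t ^ (1 / n : ℝ) := by
            rw [← add_mul, hab, one_mul]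
        _ ≤ _ := by simp only [smul_eq_mul]; gcongr
    -- The strict superlevel set is open by continuity and lies in the level set.
    exact mem_interior.2 ⟨_, fun z hz => le_of_lt hz,
      isOpen_lt continuous_const hcont, hlt⟩
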